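/- Let $N\ge 2$ and $N'=N/(N-1)$, and for $t\in\mathbb{R}$ put $$\Phi_N(t)=\sum_{k\ge N-1}\frac{|t|^{kN'}}{k!}.$$ There are constants $c_1,c_2>0$, depending only on $N$, with the following property. Let $\Omega\subset\mathbb{R}^N$ be any domain (connected open set) with $\partial\Omega\neq\emptyset$; no smoothness or boundedness of $\Omega$ is assumed. Let $\delta(x)$ denote the distance of $x$ from $\partial\Omega$. Then every real-valued $u\in W_0^{1,N}(\Omega)$ (the closure of $C_c^\infty(\Omega)$ in the Sobolev space $W^{1,N}(\Omega)$) with $$M_N(u):=\left(\int_\Omega |\nabla u|^N+\frac{|u|^N}{\delta^N}\,dx\right)^{1/N}=1$$ satisfies $$\int_\Omega\frac{\Phi_N(u/c_1)}{\delta^N}\,dx\le c_2.$$ -/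

import Mathlib

open MeasureTheory Filter Topology
open scoped ENNReal ContDiff

noncomputable section

namespace HardyTrudinger

variable {N : ℕ}

/-- `φ ∈ C_c^∞(Ω)`: smooth, with compact support contained in `Ω`. -/
structure IsTestFunction (Ω : Set (EuclideanSpace ℝ (Fin N)))
    (φ : EuclideanSpace ℝ (Fin N) → ℝ) : Prop where
  contDiff : ContDiff ℝ ∞ φ
  hasCompactSupport : HasCompactSupport φ
  tsupport_subset : tsupport φ ⊆ Ω

/-- `G` is a weak gradient of `u` on the open set `Ω`: both are locally integrable on `Ω`, and
`∫_Ω u ∇φ = - ∫_Ω φ G` for every test function `φ` (an equality of vectors). -/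
structure IsWeakGradient (Ω : Set (EuclideanSpace ℝ (Fin N)))
    (u : EuclideanSpace ℝ (Fin N) → ℝ)
    (G : EuclideanSpace ℝ (Fin N) → EuclideanSpace ℝ (Fin N)) : Prop where
  locallyIntegrableOn_fun : LocallyIntegrableOn u Ω
  locallyIntegrableOn_grad : LocallyIntegrableOn G Ω
  integral_eq : ∀ φ : EuclideanSpace ℝ (Fin N) → ℝ, IsTestFunction Ω φ →
    ∫ x in Ω, u x • gradient φ x = - ∫ x in Ω, φ x • G x

open Classical in
/-- The weak gradient `∇u` on `Ω` (unique up to null sets when it exists), and `0` if `u` has no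
weak gradient. -/
def weakGradient (Ω : Set (EuclideanSpace ℝ (Fin N))) (u : EuclideanSpace ℝ (Fin N) → ℝ) :
    EuclideanSpace ℝ (Fin N) → EuclideanSpace ℝ (Fin N) :=
  if h : ∃ G, IsWeakGradient Ω u G then h.choose else 0

theorem isWeakGradient_weakGradient {Ω : Set (EuclideanSpace ℝ (Fin N))}
    {u : EuclideanSpace ℝ (Fin N) → ℝ} (h : ∃ G, IsWeakGradient Ω u G) :
    IsWeakGradient Ω u (weakGradient Ω u) := by
  rw [weakGradient, dif_pos h]
  exact h.choose_spec

/-- `u ∈ W^{1,p}(Ω)`. -/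
structure MemW1 (Ω : Set (EuclideanSpace ℝ (Fin N))) (p : ℝ≥0∞)
    (u : EuclideanSpace ℝ (Fin N) → ℝ) : Prop where
  memLp : MemLp u p (volume.restrict Ω)
  exists_weakGradient : ∃ G, IsWeakGradient Ω u G
  memLp_weakGradient : MemLp (weakGradient Ω u) p (volume.restrict Ω)

/-- `u ∈ W_0^{1,p}(Ω)`: `u` lies in the closure of `C_c^∞(Ω)` in `W^{1,p}(Ω)`. -/
structure MemW10 (Ω : Set (EuclideanSpace ℝ (Fin N))) (p : ℝ≥0∞)
    (u : EuclideanSpace ℝ (Fin N) → ℝ) : Prop where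
  memW1 : MemW1 Ω p u
  exists_approx : ∃ φ : ℕ → EuclideanSpace ℝ (Fin N) → ℝ,
    (∀ n, IsTestFunction Ω (φ n)) ∧
    Tendsto (fun n => eLpNorm (fun x => u x - φ n x) p (volume.restrict Ω)) atTop (𝓝 0) ∧
    Tendsto (fun n => eLpNorm (fun x => weakGradient Ω u x - gradient (φ n) x) p
      (volume.restrict Ω)) atTop (𝓝 0)

/-- `δ(x)`, the distance of `x` from `∂Ω`. -/
def bdryDist (Ω : Set (EuclideanSpace ℝ (Fin N))) (x : EuclideanSpace ℝ (Fin N)) : ℝ :=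
  Metric.infDist x (frontier Ω)

/-- `M_p(u) = (∫_Ω |∇u|^p + |u|^p / δ^p)^{1/p}`, with values in `[0, ∞]`. -/
def M (Ω : Set (EuclideanSpace ℝ (Fin N))) (p : ℝ) (u : EuclideanSpace ℝ (Fin N) → ℝ) : ℝ≥0∞ :=
  (∫⁻ x in Ω, ENNReal.ofReal
    (‖weakGradient Ω u x‖ ^ p + |u x| ^ p / bdryDist Ω x ^ p)) ^ (1 / p)

/-- The conjugate exponent `N' = N / (N - 1)`. -/
def conjExp (N : ℕ) : ℝ := (N : ℝ) / ((N : ℝ) - 1)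

/-- `Φ_N(t) = ∑_{k ≥ N-1} |t|^{k N'} / k!`. -/
def Phi (N : ℕ) (t : ℝ) : ℝ :=
  ∑' k : {k : ℕ // N - 1 ≤ k}, |t| ^ ((k : ℝ) * conjExp N) / (Nat.factorial k : ℝ)

/-- The series defining `Φ_N` always converges. -/
theorem summable_Phi (N : ℕ) (t : ℝ) :
    Summable fun k : {k : ℕ // N - 1 ≤ k} =>
      |t| ^ ((k : ℝ) * conjExp N) / (Nat.factorial k : ℝ) := by
  have h := (Real.summable_pow_div_factorial (|t| ^ conjExp N)).comp_injective
    (Subtype.val_injective (p := fun k : ℕ => N - 1 ≤ k))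
  refine h.congr fun k => ?_
  simp only [Function.comp]
  rw [mul_comm, Real.rpow_mul (abs_nonneg t), Real.rpow_natCast]

end HardyTrudinger

end

open scoped NNReal

noncomputable section

namespace HardyTrudinger

variable {N : ℕ}

/-! The distance `δ` is replaced by a smooth `d > 0` with `|∇d| ≤ 1`, and μ denotes the measure `d⁻ᴺ
dx`. The Sobolev inequality for W^{1,1} ⊂ L^{N'}, applied to `d^{-(N-1)} v`, gives a Sobolev
inequality for μ, because (N-1)N' = N. No geometry of Ω enters beyond `|∇d| ≤ 1`.

Inserting a truncation of φ between the levels t and t + h, and using Hölder on the layer between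
them, gives μ(φ ≥ t+h)^{1/N'} ≤ C (h⁻¹ E^{1/N} μ(t ≤ φ < t+h)^{1/N'} + μ(φ ≥ t)), where E is the
energy ∫|∇φ|^N of the layer (`exists_weightMeasure_superlevel_le`). Above a fixed height t₀,
Chebyshev makes the last term absorbable. Cut [t₀, t₀ + n^{1/N'}] into n layers of thickness
n^{-1/N}. The total energy is at most 1, so at least about half of the layers have E ≤ 2/n, and
across each of these μ drops by a fixed factor θ < 1 (`le_mul_of_rpow_le`). Hence μ(φ ≥ t₀ +
n^{1/N'}) ≤ θ^{n/2} (`exists_weightMeasure_superlevel_le_rpow`).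

This decay makes the exponential integral over large values finite, while Φ_N(t) ≤ e|t|^N for |t| ≤
1 handles small values. The result passes to W_0^{1,N} by density and to `δ` by letting `d` tend to
`δ`, with Fatou's lemma both times. -/

theorem holderConjugate_conjExp (hN : 2 ≤ N) : (N : ℝ).HolderConjugate (conjExp N) := by
  have h : (1 : ℝ) < N := by exact_mod_cast (show 1 < N by omega)
  exact Real.HolderConjugate.conjExponent h

/-- The weight `d⁻¹` as an extended nonnegative real. -/
def weight (d : EuclideanSpace ℝ (Fin N) → ℝ) (x : EuclideanSpace ℝ (Fin N)) : ℝ≥0∞ :=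
  ENNReal.ofReal (d x)⁻¹

/-- The measure `d⁻ᴺ dx`. -/
def weightMeasure (d : EuclideanSpace ℝ (Fin N) → ℝ) : Measure (EuclideanSpace ℝ (Fin N)) :=
  volume.withDensity fun x => weight d x ^ N

/-! ### The weighted Sobolev inequality -/

theorem measurable_weight {d : EuclideanSpace ℝ (Fin N) → ℝ} (hd : Continuous d) :
    Measurable (weight d) :=
  hd.measurable.inv.ennreal_ofReal

theorem enorm_inv_eq_weight {d : EuclideanSpace ℝ (Fin N) → ℝ} (hd0 : ∀ x, 0 < d x)
    (x : EuclideanSpace ℝ (Fin N)) : ‖(d x)⁻¹‖ₑ = weight d x :=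
  Real.enorm_of_nonneg (inv_nonneg.2 (hd0 x).le)

/-- Product rule: differentiating the weight costs one more factor `d⁻¹`, since `|∇d| ≤ 1`, and so
produces exactly the density `d⁻ᴺ` of the weighted measure. -/
theorem norm_fderiv_inv_pow_mul_le (hN : 2 ≤ N) {d v : EuclideanSpace ℝ (Fin N) → ℝ}
    {x : EuclideanSpace ℝ (Fin N)} (hd : DifferentiableAt ℝ d x) (hd0 : 0 < d x)
    (hd1 : ‖fderiv ℝ d x‖ ≤ 1) (hv : DifferentiableAt ℝ v x) :
    ‖fderiv ℝ (fun y => (d y)⁻¹ ^ (N - 1) * v y) x‖ ≤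
      (d x)⁻¹ ^ (N - 1) * ‖fderiv ℝ v x‖ + ((N - 1 : ℕ) : ℝ) * (d x)⁻¹ ^ N * |v x| := by
  obtain ⟨m, rfl⟩ := Nat.exists_eq_add_of_le' hN
  have h1 : HasFDerivAt (fun y => (d y)⁻¹ ^ (m + 1))
      ((((m + 1 : ℕ) : ℝ) * (d x)⁻¹ ^ m * (-(d x ^ 2)⁻¹)) • fderiv ℝ d x) x := by
    simpa [Function.comp_def] using
      ((hasDerivAt_inv hd0.ne').pow (m + 1)).comp_hasFDerivAt x hd.hasFDerivAt
  have h2 : HasFDerivAt (fun y => (d y)⁻¹ ^ (m + 1) * v y) _ x := h1.mul hv.hasFDerivAt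
  have e : (d x)⁻¹ ^ (m + 2) = (d x)⁻¹ ^ m * (d x ^ 2)⁻¹ := by
    rw [pow_add, inv_pow (d x) 2]
  have hd0' : 0 ≤ (d x)⁻¹ := inv_nonneg.2 hd0.le
  rw [show m + 2 - 1 = m + 1 by omega]
  rw [h2.fderiv]
  refine (norm_add_le _ _).trans ?_
  rw [norm_smul, norm_smul, norm_smul, Real.norm_of_nonneg (pow_nonneg hd0' _), e]
  refine add_le_add le_rfl ?_
  rw [norm_mul, norm_mul, norm_neg, Real.norm_natCast, Real.norm_of_nonneg (pow_nonneg hd0' m),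
    Real.norm_of_nonneg (inv_nonneg.2 (sq_nonneg (d x))), Real.norm_eq_abs]
  calc |v x| * (((m + 1 : ℕ) : ℝ) * (d x)⁻¹ ^ m * (d x ^ 2)⁻¹ * ‖fderiv ℝ d x‖)
      ≤ |v x| * (((m + 1 : ℕ) : ℝ) * (d x)⁻¹ ^ m * (d x ^ 2)⁻¹ * 1) := by gcongr
    _ = _ := by ring

theorem enorm_fderiv_inv_pow_mul_le (hN : 2 ≤ N) {d v : EuclideanSpace ℝ (Fin N) → ℝ}
    {x : EuclideanSpace ℝ (Fin N)} (hd : DifferentiableAt ℝ d x) (hd0 : 0 < d x)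
    (hd1 : ‖fderiv ℝ d x‖ ≤ 1) (hv : DifferentiableAt ℝ v x) :
    ‖fderiv ℝ (fun y => (d y)⁻¹ ^ (N - 1) * v y) x‖ₑ ≤
      weight d x ^ (N - 1) * ‖fderiv ℝ v x‖ₑ +
        ((N - 1 : ℕ) : ℝ≥0∞) * (weight d x ^ N * ‖v x‖ₑ) := by
  have h := norm_fderiv_inv_pow_mul_le hN hd hd0 hd1 hv
  have hd0' : 0 ≤ (d x)⁻¹ := inv_nonneg.2 hd0.le
  rw [← ofReal_norm, ← ofReal_norm, ← ofReal_norm, weight, ← ENNReal.ofReal_pow hd0',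
    ← ENNReal.ofReal_pow hd0', ← ENNReal.ofReal_mul (by positivity),
    ← ENNReal.ofReal_mul (by positivity), ← ENNReal.ofReal_natCast,
    ← ENNReal.ofReal_mul (by positivity), ← ENNReal.ofReal_add (by positivity) (by positivity)]
  refine ENNReal.ofReal_le_ofReal (h.trans (le_of_eq ?_))
  rw [Real.norm_eq_abs, mul_assoc]

theorem weight_pow_sub_one_rpow (hN : 2 ≤ N) (a : ℝ≥0∞) :
    (a ^ (N - 1)) ^ conjExp N = a ^ N := by
  have h : (1 : ℝ) < N := by exact_mod_cast (show 1 < N by omega)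
  rw [← ENNReal.rpow_natCast, ← ENNReal.rpow_mul, ← ENNReal.rpow_natCast, conjExp,
    Nat.cast_sub (by omega), Nat.cast_one]
  congr 1
  field_simp [(sub_pos.2 h).ne']

/-- The weighted Gagliardo–Nirenberg–Sobolev inequality. -/
theorem lintegral_weight_mul_rpow_le (hN : 2 ≤ N) {d v : EuclideanSpace ℝ (Fin N) → ℝ}
    (hd : ContDiff ℝ 1 d) (hd0 : ∀ x, 0 < d x) (hd1 : ∀ x, ‖fderiv ℝ d x‖ ≤ 1)
    (hv : ContDiff ℝ 1 v) (hvc : HasCompactSupport v) :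
    ∫⁻ x, weight d x ^ N * ‖v x‖ₑ ^ conjExp N ≤
      lintegralPowLePowLIntegralFDerivConst
        (volume : Measure (EuclideanSpace ℝ (Fin N))) (conjExp N) *
      (∫⁻ x, (weight d x ^ (N - 1) * ‖fderiv ℝ v x‖ₑ +
        ((N - 1 : ℕ) : ℝ≥0∞) * (weight d x ^ N * ‖v x‖ₑ))) ^ conjExp N := by
  have hp := holderConjugate_conjExp hN
  have hp' : ((Module.finrank ℝ (EuclideanSpace ℝ (Fin N)) : ℕ) : ℝ).HolderConjugate
      (conjExp N) := by simpa using hp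
  -- The N'-th power of this function is the integrand on the left.
  have hu : ContDiff ℝ 1 (fun y => (d y)⁻¹ ^ (N - 1) * v y) :=
    ((hd.inv fun x => (hd0 x).ne').pow _).mul hv
  have key := lintegral_pow_le_pow_lintegral_fderiv
    (volume : Measure (EuclideanSpace ℝ (Fin N))) hu hvc.mul_left hp'
  refine le_trans (le_of_eq ?_) (key.trans ?_)
  · refine lintegral_congr fun x => ?_
    rw [enorm_mul, enorm_pow, enorm_inv_eq_weight hd0,
      ENNReal.mul_rpow_of_nonneg _ _ hp.symm.nonneg, weight_pow_sub_one_rpow hN]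
  · gcongr with x
    · exact hp.symm.nonneg
    · exact enorm_fderiv_inv_pow_mul_le hN (hd.differentiable one_ne_zero x) (hd0 x) (hd1 x)
        (hv.differentiable one_ne_zero x)

/-! ### Truncation between two levels -/

/-- At such points the function attains its global minimum 0 or maximum 1. The half-open interval
matches the layers `t ≤ φ < t + h`, which tile without overlap. -/
theorem deriv_smoothTransition_of_notMem {s : ℝ} (hs : s ∉ Set.Ico (0 : ℝ) 1) :
    deriv Real.smoothTransition s = 0 := by
  by_cases h : 0 ≤ s
  · have h1 : 1 ≤ s := by
      by_contra h1
      exact hs ⟨h, not_le.1 h1⟩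
    refine IsLocalMax.deriv_eq_zero (Eventually.of_forall fun y => ?_)
    rw [Real.smoothTransition.one_of_one_le h1]
    exact Real.smoothTransition.le_one y
  · refine IsLocalMin.deriv_eq_zero (Eventually.of_forall fun y => ?_)
    rw [Real.smoothTransition.zero_of_nonpos (not_le.1 h).le]
    exact Real.smoothTransition.nonneg y

theorem exists_norm_deriv_smoothTransition_le :
    ∃ L : ℝ≥0, ∀ s, ‖deriv Real.smoothTransition s‖ ≤ L := by
  have hc : Continuous (deriv Real.smoothTransition) :=
    (Real.smoothTransition.contDiff (n := 1)).continuous_deriv le_rfl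
  obtain ⟨C, hC⟩ := (isCompact_Icc (a := (0 : ℝ)) (b := 1)).exists_bound_of_continuousOn
    hc.continuousOn
  refine ⟨C.toNNReal, fun s => ?_⟩
  by_cases hs : s ∈ Set.Ico (0 : ℝ) 1
  · exact (hC s ⟨hs.1, hs.2.le⟩).trans (Real.le_coe_toNNReal C)
  · rw [deriv_smoothTransition_of_notMem hs, norm_zero]
    exact NNReal.coe_nonneg _

theorem hasFDerivAt_smoothTransition_comp {φ : EuclideanSpace ℝ (Fin N) → ℝ} (t h : ℝ)
    {x : EuclideanSpace ℝ (Fin N)} (hφ : DifferentiableAt ℝ φ x) :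
    HasFDerivAt (fun y => Real.smoothTransition (h⁻¹ * (φ y - t)))
      (deriv Real.smoothTransition (h⁻¹ * (φ x - t)) • h⁻¹ • fderiv ℝ φ x) x := by
  have h1 : HasDerivAt Real.smoothTransition (deriv Real.smoothTransition (h⁻¹ * (φ x - t)))
      (h⁻¹ * (φ x - t)) :=
    ((Real.smoothTransition.contDiff (n := 1)).differentiable one_ne_zero _).hasDerivAt
  exact h1.comp_hasFDerivAt x ((hφ.hasFDerivAt.sub_const t).const_mul h⁻¹)

theorem lintegral_weightMeasure {d : EuclideanSpace ℝ (Fin N) → ℝ} (hd : Continuous d)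
    {f : EuclideanSpace ℝ (Fin N) → ℝ≥0∞} (hf : Measurable f) :
    ∫⁻ x, f x ∂weightMeasure d = ∫⁻ x, weight d x ^ N * f x := by
  rw [weightMeasure, lintegral_withDensity_eq_lintegral_mul _ ((measurable_weight hd).pow_const N)
    hf]
  rfl

theorem weightMeasure_eq_lintegral_indicator {d : EuclideanSpace ℝ (Fin N) → ℝ}
    (hd : Continuous d) {s : Set (EuclideanSpace ℝ (Fin N))} (hs : MeasurableSet s) :
    weightMeasure d s = ∫⁻ x, weight d x ^ N * s.indicator 1 x := by
  rw [← lintegral_weightMeasure hd (measurable_one.indicator hs), lintegral_indicator_one hs]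

/-- The weighted Sobolev inequality for a truncation v of φ: v = 1 on the upper superlevel set, ∇v
lives on the layer, and the zero-order term lives on the lower superlevel set. The constant depends
on N alone. -/
theorem exists_weightMeasure_superlevel_le (hN : 2 ≤ N) :
    ∃ C : ℝ≥0, ∀ d φ : EuclideanSpace ℝ (Fin N) → ℝ, ContDiff ℝ 1 d → (∀ x, 0 < d x) →
      (∀ x, ‖fderiv ℝ d x‖ ≤ 1) → ContDiff ℝ 1 φ → HasCompactSupport φ →
      ∀ t h : ℝ, 0 < t → 0 < h →
        weightMeasure d {x | t + h ≤ φ x} ^ (1 / conjExp N) ≤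
          C * (ENNReal.ofReal h⁻¹ *
            ((∫⁻ x in {x | t ≤ φ x ∧ φ x < t + h}, ‖fderiv ℝ φ x‖ₑ ^ N) ^ (1 / (N : ℝ)) *
              weightMeasure d {x | t ≤ φ x ∧ φ x < t + h} ^ (1 / conjExp N)) +
            weightMeasure d {x | t ≤ φ x}) := by
  have hp := holderConjugate_conjExp hN
  obtain ⟨L, hL⟩ := exists_norm_deriv_smoothTransition_le
  set C₀ := lintegralPowLePowLIntegralFDerivConst
        (volume : Measure (EuclideanSpace ℝ (Fin N))) (conjExp N) with hC₀
  -- The root of the Sobolev constant, times the slope L of the cutoff plus the factor N-1 from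
  -- differentiating the weight.
  refine ⟨C₀ ^ (1 / conjExp N) * (L + (N - 1 : ℕ)), ?_⟩
  intro d φ hd hd0 hd1 hφ hφc t h ht hh
  have hcd := hd.continuous
  have hcφ := hφ.continuous
  set A : Set (EuclideanSpace ℝ (Fin N)) := {x | t ≤ φ x ∧ φ x < t + h} with hA
  have hAm : MeasurableSet A :=
    (measurableSet_le measurable_const hcφ.measurable).inter
      (measurableSet_lt hcφ.measurable measurable_const)
  have hTm : MeasurableSet {x | t ≤ φ x} := measurableSet_le measurable_const hcφ.measurable
  have hHm : MeasurableSet {x | t + h ≤ φ x} := measurableSet_le measurable_const hcφ.measurable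
  have hWm := measurable_weight hcd
  have hFm : Measurable fun x => ‖fderiv ℝ φ x‖ₑ :=
    (hφ.continuous_fderiv one_ne_zero).measurable.enorm
  set v : EuclideanSpace ℝ (Fin N) → ℝ :=
    fun x => Real.smoothTransition (h⁻¹ * (φ x - t)) with hv
  have hvC : ContDiff ℝ 1 v :=
    Real.smoothTransition.contDiff.comp (contDiff_const.mul (hφ.sub contDiff_const))
  have hvc : HasCompactSupport v := by
    refine hφc.comp_left (g := fun s => Real.smoothTransition (h⁻¹ * (s - t))) ?_
    -- Positivity of t is used here: the truncation must vanish where φ does.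
    refine Real.smoothTransition.zero_of_nonpos ?_
    have := inv_pos.2 hh
    nlinarith
  have hgrad : ∀ x, ‖fderiv ℝ v x‖ₑ ≤
      A.indicator (fun x => L * ENNReal.ofReal h⁻¹ * ‖fderiv ℝ φ x‖ₑ) x := by
    intro x
    rw [(hasFDerivAt_smoothTransition_comp t h (hφ.differentiable one_ne_zero x)).fderiv]
    by_cases hx : x ∈ A
    · rw [Set.indicator_of_mem hx, enorm_smul, enorm_smul, ← mul_assoc,
        Real.enorm_of_nonneg (inv_nonneg.2 hh.le)]
      gcongr
      rw [← ofReal_norm, ← ENNReal.ofReal_coe_nnreal]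
      exact ENNReal.ofReal_le_ofReal (hL _)
    · rw [Set.indicator_of_notMem hx, deriv_smoothTransition_of_notMem, zero_smul]
      · exact (ofReal_norm _).symm.le.trans (by simp)
      · rintro ⟨h0, h1⟩
        refine hx ⟨?_, ?_⟩
        · have := (mul_nonneg_iff_of_pos_left (inv_pos.2 hh)).1 h0
          linarith
        · rw [inv_mul_lt_iff₀ hh] at h1
          linarith
  have hval : ∀ x, ‖v x‖ₑ ≤ {x | t ≤ φ x}.indicator 1 x := by
    intro x
    by_cases hx : x ∈ {x | t ≤ φ x}
    · rw [Set.indicator_of_mem hx, Real.enorm_of_nonneg (Real.smoothTransition.nonneg _),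
        Pi.one_apply, ENNReal.ofReal_le_one]
      exact Real.smoothTransition.le_one _
    · rw [Set.indicator_of_notMem hx, hv]
      have : φ x < t := not_le.1 hx
      simp only
      rw [Real.smoothTransition.zero_of_nonpos, enorm_zero]
      exact mul_nonpos_of_nonneg_of_nonpos (inv_nonneg.2 hh.le) (by linarith)
  have hlow : weightMeasure d {x | t + h ≤ φ x} ≤
      ∫⁻ x, weight d x ^ N * ‖v x‖ₑ ^ conjExp N := by
    rw [weightMeasure_eq_lintegral_indicator hcd hHm]
    refine lintegral_mono fun x => ?_
    by_cases hx : x ∈ {x | t + h ≤ φ x}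
    · have h1 : v x = 1 := by
        refine Real.smoothTransition.one_of_one_le ?_
        have : t + h ≤ φ x := hx
        rw [le_inv_mul_iff₀ hh]
        linarith
      simp [Set.indicator_of_mem hx, h1]
    · simp [Set.indicator_of_notMem hx]
  have hHolder : ∫⁻ x in A, ‖fderiv ℝ φ x‖ₑ * weight d x ^ (N - 1) ≤
      (∫⁻ x in A, ‖fderiv ℝ φ x‖ₑ ^ N) ^ (1 / (N : ℝ)) *
        weightMeasure d A ^ (1 / conjExp N) := by
    refine (ENNReal.lintegral_mul_le_Lp_mul_Lq (volume.restrict A) hp hFm.aemeasurable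
      (hWm.pow_const (N - 1)).aemeasurable).trans (le_of_eq ?_)
    simp only [ENNReal.rpow_natCast, weight_pow_sub_one_rpow hN]
    rw [weightMeasure, withDensity_apply _ hAm]
  have hI : ∫⁻ x, (weight d x ^ (N - 1) * ‖fderiv ℝ v x‖ₑ +
        ((N - 1 : ℕ) : ℝ≥0∞) * (weight d x ^ N * ‖v x‖ₑ)) ≤
      L * (ENNReal.ofReal h⁻¹ *
            ((∫⁻ x in A, ‖fderiv ℝ φ x‖ₑ ^ N) ^ (1 / (N : ℝ)) *
              weightMeasure d A ^ (1 / conjExp N))) +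
        ((N - 1 : ℕ) : ℝ≥0∞) * weightMeasure d {x | t ≤ φ x} := by
    calc _ ≤ ∫⁻ x, (A.indicator (fun x => (L * ENNReal.ofReal h⁻¹) *
              (‖fderiv ℝ φ x‖ₑ * weight d x ^ (N - 1))) x +
            ((N - 1 : ℕ) : ℝ≥0∞) * (weight d x ^ N * {x | t ≤ φ x}.indicator 1 x)) := by
          refine lintegral_mono fun x => add_le_add ?_ ?_
          · refine (mul_le_mul_right (hgrad x) _).trans (le_of_eq ?_)
            by_cases hx : x ∈ A
            · rw [Set.indicator_of_mem hx, Set.indicator_of_mem hx]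
              ring
            · simp [Set.indicator_of_notMem hx]
          · gcongr
            exact hval x
      _ = (L * ENNReal.ofReal h⁻¹) * (∫⁻ x in A, ‖fderiv ℝ φ x‖ₑ * weight d x ^ (N - 1)) +
            ((N - 1 : ℕ) : ℝ≥0∞) * weightMeasure d {x | t ≤ φ x} := by
          rw [lintegral_add_left, lintegral_indicator hAm, lintegral_const_mul,
            lintegral_const_mul, weightMeasure_eq_lintegral_indicator hcd hTm]
          · exact (hWm.pow_const N).mul (measurable_one.indicator hTm)
          · exact hFm.mul (hWm.pow_const _)
          · exact ((hFm.mul (hWm.pow_const _)).const_mul _).indicator hAm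
      _ ≤ _ := by
          rw [mul_assoc]
          gcongr
  have hmain := hlow.trans (lintegral_weight_mul_rpow_le hN hd hd0 hd1 hvC hvc)
  have hinv : 0 ≤ 1 / conjExp N := by have := hp.symm.pos; positivity
  calc weightMeasure d {x | t + h ≤ φ x} ^ (1 / conjExp N)
      ≤ (C₀ * (∫⁻ x, (weight d x ^ (N - 1) * ‖fderiv ℝ v x‖ₑ +
        ((N - 1 : ℕ) : ℝ≥0∞) * (weight d x ^ N * ‖v x‖ₑ))) ^ conjExp N) ^ (1 / conjExp N) :=
        ENNReal.rpow_le_rpow hmain hinv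
    _ = (C₀ : ℝ≥0∞) ^ (1 / conjExp N) * ∫⁻ x, (weight d x ^ (N - 1) * ‖fderiv ℝ v x‖ₑ +
        ((N - 1 : ℕ) : ℝ≥0∞) * (weight d x ^ N * ‖v x‖ₑ)) := by
        rw [ENNReal.mul_rpow_of_nonneg _ _ hinv, ← ENNReal.rpow_mul,
          mul_one_div_cancel hp.symm.pos.ne', ENNReal.rpow_one]
    _ ≤ (C₀ : ℝ≥0∞) ^ (1 / conjExp N) * (L * (ENNReal.ofReal h⁻¹ *
            ((∫⁻ x in A, ‖fderiv ℝ φ x‖ₑ ^ N) ^ (1 / (N : ℝ)) *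
              weightMeasure d A ^ (1 / conjExp N))) +
        ((N - 1 : ℕ) : ℝ≥0∞) * weightMeasure d {x | t ≤ φ x}) := by gcongr
    _ ≤ (C₀ : ℝ≥0∞) ^ (1 / conjExp N) * ((L + (N - 1 : ℕ)) * (ENNReal.ofReal h⁻¹ *
            ((∫⁻ x in A, ‖fderiv ℝ φ x‖ₑ ^ N) ^ (1 / (N : ℝ)) *
              weightMeasure d A ^ (1 / conjExp N)) + weightMeasure d {x | t ≤ φ x})) := by
        rw [mul_add (↑L + _ : ℝ≥0∞)]
        gcongr
        · exact le_self_add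
        · exact le_add_self
    _ = _ := by
        rw [← mul_assoc]
        congr 1
        push_cast [ENNReal.coe_rpow_of_nonneg _ hinv]
        rfl

/-! ### Exponential decay of superlevel sets -/

/-- A pigeonhole argument in multiplicative form: every step contracts by θ^{1 - n e_j/2}. When n
e_j > 2 the exponent is negative and monotonicity suffices. The exponents add up to at least n/2. -/
theorem le_rpow_half_mul_of_dichotomy {m e : ℕ → ℝ} {θ : ℝ} (hθ0 : 0 < θ) (hθ1 : θ < 1) {n : ℕ}
    (hm : ∀ j, 0 ≤ m j) (he : ∀ j, 0 ≤ e j) (hanti : ∀ j < n, m (j + 1) ≤ m j)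
    (hstep : ∀ j < n, n * e j ≤ 2 → m (j + 1) ≤ θ * m j)
    (hsum : ∑ j ∈ Finset.range n, e j ≤ 1) :
    m n ≤ θ ^ ((n : ℝ) / 2) * m 0 := by
  have hone : ∀ j < n, m (j + 1) ≤ θ ^ (1 - n * e j / 2) * m j := by
    intro j hj
    by_cases h : n * e j ≤ 2
    · refine (hstep j hj h).trans (mul_le_mul_of_nonneg_right ?_ (hm j))
      have : 0 ≤ n * e j := mul_nonneg n.cast_nonneg (he j)
      calc θ = θ ^ (1 : ℝ) := (Real.rpow_one θ).symm
        _ ≤ _ := Real.rpow_le_rpow_of_exponent_ge hθ0 hθ1.le (by linarith)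
    · refine (hanti j hj).trans (le_mul_of_one_le_left (hm j) ?_)
      exact Real.one_le_rpow_of_pos_of_le_one_of_nonpos hθ0 hθ1.le (by linarith)
  have hind : ∀ i ≤ n, m i ≤ θ ^ (∑ j ∈ Finset.range i, (1 - n * e j / 2)) * m 0 := by
    intro i
    induction i with
    | zero => simp
    | succ i ih =>
      intro hi
      rw [Finset.sum_range_succ, Real.rpow_add hθ0]
      calc m (i + 1) ≤ θ ^ (1 - n * e i / 2) * m i := hone i hi
        _ ≤ θ ^ (1 - n * e i / 2) * (θ ^ (∑ j ∈ Finset.range i, (1 - n * e j / 2)) * m 0) := by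
          gcongr
          exact ih (by omega)
        _ = _ := by ring
  refine (hind n le_rfl).trans (mul_le_mul_of_nonneg_right ?_ (hm 0))
  refine Real.rpow_le_rpow_of_exponent_ge hθ0 hθ1.le ?_
  rw [Finset.sum_sub_distrib, ← Finset.sum_div, ← Finset.mul_sum]
  simp only [Finset.sum_const, Finset.card_range, nsmul_eq_mul, mul_one]
  have : (n : ℝ) * ∑ j ∈ Finset.range n, e j ≤ n * 1 := by gcongr
  linarith

/-- At θ = 1 the inequality reads 1/2 < 1, so it persists for θ slightly smaller. -/
theorem exists_rpow_lt_rpow (B p : ℝ) (hp : 0 < p) :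
    ∃ θ : ℝ, 0 < θ ∧ θ < 1 ∧ B * (1 - θ) ^ p + 1 / 2 < θ ^ p := by
  have hc : ContinuousAt (fun θ : ℝ => θ ^ p - (B * (1 - θ) ^ p + 1 / 2)) 1 := by
    refine (Real.continuousAt_rpow_const _ _ (Or.inr hp.le)).sub ?_
    refine (continuousAt_const.mul ?_).add continuousAt_const
    exact (Continuous.rpow_const (continuous_const.sub continuous_id)
      fun _ => Or.inr hp.le).continuousAt
  have hpos : 0 < (fun θ : ℝ => θ ^ p - (B * (1 - θ) ^ p + 1 / 2)) 1 := by
    simp only [Real.one_rpow, sub_self, Real.zero_rpow hp.ne']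
    norm_num
  have h1 : ∀ᶠ θ in 𝓝[<] (1 : ℝ), 0 < θ ^ p - (B * (1 - θ) ^ p + 1 / 2) :=
    (hc.eventually (lt_mem_nhds hpos)).filter_mono nhdsWithin_le_nhds
  have h2 : ∀ᶠ θ in 𝓝[<] (1 : ℝ), θ ∈ Set.Ioo (0 : ℝ) 1 :=
    Ioo_mem_nhdsLT one_pos
  obtain ⟨θ, h, h'⟩ := (h1.and h2).exists
  exact ⟨θ, h'.1, h'.2, by linarith⟩

theorem ofReal_pow_mul_weightMeasure_superlevel_le {d φ : EuclideanSpace ℝ (Fin N) → ℝ}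
    (hφ : Continuous φ) (hV : ∫⁻ x, ‖φ x‖ₑ ^ N ∂weightMeasure d ≤ 1) (t : ℝ) :
    ENNReal.ofReal t ^ N * weightMeasure d {x | t ≤ φ x} ≤ 1 := by
  refine le_trans ?_ ((mul_meas_ge_le_lintegral₀ (hφ.measurable.enorm.pow_const N).aemeasurable
    (ENNReal.ofReal t ^ N)).trans hV)
  gcongr
  intro hx
  gcongr
  rw [← ofReal_norm]
  exact ENNReal.ofReal_le_ofReal (le_trans hx (le_abs_self _))

/-- Here a, b are the measures at consecutive levels and q is the energy between them. If b > θa,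
then a - b < (1-θ)a, while n q ≤ 2 gives h⁻¹q^{1/N} ≤ 2^{1/N} and the bounds on t₀ give C a ≤
a^{1/N'}/2. Together these contradict the choice of θ. -/
theorem le_mul_of_rpow_le {C t₀ θ a b q h : ℝ} {n : ℕ} (hN : 2 ≤ N) (hC : 0 ≤ C)
    (ht₀ : 0 < t₀) (hCt : 2 * C ≤ t₀) (hθ0 : 0 < θ) (hθ1 : θ < 1)
    (hθ : C * 2 ^ (1 / (N : ℝ)) * (1 - θ) ^ (1 / conjExp N) + 1 / 2 < θ ^ (1 / conjExp N))
    (ha : 0 ≤ a) (hba : b ≤ a) (hq : 0 ≤ q) (hn : 0 < n)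
    (hh : h = (n : ℝ) ^ (-(1 / (N : ℝ)))) (hat : t₀ ^ N * a ≤ 1) (hnq : n * q ≤ 2)
    (hab : b ^ (1 / conjExp N) ≤
      C * (h⁻¹ * (q ^ (1 / (N : ℝ)) * (a - b) ^ (1 / conjExp N)) + a)) :
    b ≤ θ * a := by
  have hp := holderConjugate_conjExp hN
  have hr : 0 < 1 / conjExp N := by have := hp.symm.pos; positivity
  have hs : 0 < 1 / (N : ℝ) := by have := hp.pos; positivity
  have hn' : (0 : ℝ) < n := by exact_mod_cast hn
  rcases ha.eq_or_lt with rfl | ha'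
  · linarith
  by_contra hlt
  rw [not_le] at hlt
  have h1 : h⁻¹ * q ^ (1 / (N : ℝ)) ≤ 2 ^ (1 / (N : ℝ)) := by
    rw [hh, Real.rpow_neg hn'.le, inv_inv, ← Real.mul_rpow hn'.le hq]
    exact Real.rpow_le_rpow (by positivity) hnq hs.le
  have h2 : (a - b) ^ (1 / conjExp N) ≤ (1 - θ) ^ (1 / conjExp N) * a ^ (1 / conjExp N) := by
    rw [← Real.mul_rpow (by linarith) ha]
    exact Real.rpow_le_rpow (by linarith) (by linarith) hr.le
  have h3 : C * a ≤ 1 / 2 * a ^ (1 / conjExp N) := by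
    have e : a = a ^ (1 / (N : ℝ)) * a ^ (1 / conjExp N) := by
      rw [← Real.rpow_add ha', one_div, one_div, hp.inv_add_inv_eq_one, Real.rpow_one]
    have h4 : t₀ * a ^ (1 / (N : ℝ)) ≤ 1 := by
      have := Real.rpow_le_rpow (by positivity) hat hs.le
      rwa [Real.mul_rpow (by positivity) ha, Real.one_rpow, one_div,
        Real.pow_rpow_inv_natCast ht₀.le (by omega), ← one_div] at this
    have h5 : C * a ^ (1 / (N : ℝ)) ≤ 1 / 2 := by
      have : 0 ≤ a ^ (1 / (N : ℝ)) := by positivity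
      nlinarith
    calc C * a = C * a ^ (1 / (N : ℝ)) * a ^ (1 / conjExp N) := by
          rw [mul_assoc, ← e]
      _ ≤ _ := by gcongr
  have h6 : θ ^ (1 / conjExp N) * a ^ (1 / conjExp N) ≤ b ^ (1 / conjExp N) := by
    rw [← Real.mul_rpow hθ0.le ha]
    exact Real.rpow_le_rpow (by positivity) hlt.le hr.le
  have h7 : b ^ (1 / conjExp N) ≤ C * (2 ^ (1 / (N : ℝ)) *
      ((1 - θ) ^ (1 / conjExp N) * a ^ (1 / conjExp N))) + 1 / 2 * a ^ (1 / conjExp N) := by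
    refine hab.trans ?_
    rw [mul_add, ← mul_assoc h⁻¹]
    have : 0 ≤ (a - b) ^ (1 / conjExp N) := Real.rpow_nonneg (by linarith) _
    gcongr
  have h8 : 0 < a ^ (1 / conjExp N) := by positivity
  nlinarith [mul_lt_mul_of_pos_right hθ h8]

theorem weightMeasure_level_eq_sub {d φ : EuclideanSpace ℝ (Fin N) → ℝ}
    (hφ : Continuous φ) {t s : ℝ} (hts : t ≤ s) (hfin : weightMeasure d {x | s ≤ φ x} ≠ ⊤) :
    weightMeasure d {x | t ≤ φ x ∧ φ x < s} =
      weightMeasure d {x | t ≤ φ x} - weightMeasure d {x | s ≤ φ x} := by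
  rw [← measure_sdiff (show {x | s ≤ φ x} ⊆ {x | t ≤ φ x} from fun x hx => hts.trans hx)
    (measurableSet_le measurable_const hφ.measurable).nullMeasurableSet hfin]
  congr 1
  ext x
  simp

/-- Exponential decay, in the power `N'` of the level, of the superlevel sets. -/
theorem exists_weightMeasure_superlevel_le_rpow (hN : 2 ≤ N) :
    ∃ t₀ θ : ℝ, 1 ≤ t₀ ∧ 0 < θ ∧ θ < 1 ∧
      ∀ d φ : EuclideanSpace ℝ (Fin N) → ℝ, ContDiff ℝ 1 d → (∀ x, 0 < d x) →
      (∀ x, ‖fderiv ℝ d x‖ ≤ 1) → ContDiff ℝ 1 φ → HasCompactSupport φ →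
      ∫⁻ x, ‖fderiv ℝ φ x‖ₑ ^ N ≤ 1 → ∫⁻ x, ‖φ x‖ₑ ^ N ∂weightMeasure d ≤ 1 →
      ∀ n : ℕ, weightMeasure d {x | t₀ + (n : ℝ) ^ (1 / conjExp N) ≤ φ x} ≤
        ENNReal.ofReal (θ ^ ((n : ℝ) / 2)) := by
  have hp := holderConjugate_conjExp hN
  have hr : 0 < 1 / conjExp N := by have := hp.symm.pos; positivity
  have hs : 0 < 1 / (N : ℝ) := by have := hp.pos; positivity
  obtain ⟨C, hC⟩ := exists_weightMeasure_superlevel_le hN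
  obtain ⟨θ, hθ0, hθ1, hθ⟩ := exists_rpow_lt_rpow (C * 2 ^ (1 / (N : ℝ))) (1 / conjExp N) hr
  -- By Chebyshev, t₀ ≥ 1 makes the measures above t₀ at most 1, and t₀ ≥ 2C allows the absorption
  -- of the zero-order term.
  refine ⟨max 1 (2 * C), θ, le_max_left _ _, hθ0, hθ1, ?_⟩
  intro d φ hd hd0 hd1 hφ hφc hG hV n
  set t₀ : ℝ := max 1 (2 * C) with ht₀
  have ht1 : 1 ≤ t₀ := le_max_left _ _
  have ht0 : 0 < t₀ := one_pos.trans_le ht1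
  have hcφ := hφ.continuous
  have hcheb : ∀ t, t₀ ≤ t →
      ENNReal.ofReal t₀ ^ N * weightMeasure d {x | t ≤ φ x} ≤ 1 := fun t ht => by
    refine le_trans ?_ (ofReal_pow_mul_weightMeasure_superlevel_le hcφ hV t₀)
    gcongr
  have hle1 : ∀ t, t₀ ≤ t → weightMeasure d {x | t ≤ φ x} ≤ 1 := fun t ht => by
    refine le_trans ?_ (hcheb t ht)
    refine le_mul_of_one_le_left' (one_le_pow₀ ?_)
    rwa [ENNReal.one_le_ofReal]
  have hfin : ∀ t, t₀ ≤ t → weightMeasure d {x | t ≤ φ x} ≠ ⊤ := fun t ht =>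
    ((hle1 t ht).trans_lt ENNReal.one_lt_top).ne
  rcases Nat.eq_zero_or_pos n with rfl | hn
  · simpa [Real.zero_rpow hr.ne', hp.symm.pos.ne'] using hle1 t₀ le_rfl
  have hn' : (0 : ℝ) < n := by exact_mod_cast hn
  -- With this thickness n layers reach height n^{1/N'}, and energy at most 2/n in a layer keeps
  -- h⁻¹E^{1/N} bounded independently of n.
  obtain ⟨h, hh⟩ : ∃ h : ℝ, h = (n : ℝ) ^ (-(1 / (N : ℝ))) := ⟨_, rfl⟩
  have hh0 : 0 < h := by rw [hh]; positivity
  have hnh : (n : ℝ) ^ (1 / conjExp N) = n * h := by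
    rw [hh, ← Real.rpow_one_add' hn'.le]
    · congr 1
      have := hp.inv_add_inv_eq_one
      rw [one_div, one_div]
      linarith
    · have := hp.inv_add_inv_eq_one
      rw [one_div, ← sub_eq_add_neg, ← this, add_sub_cancel_left, ← one_div]
      exact hr.ne'
  have hlev : ∀ j : ℕ, t₀ ≤ t₀ + j * h := fun j => by
    have : (0 : ℝ) ≤ j * h := by positivity
    linarith
  have hlev' : ∀ j : ℕ, t₀ + j * h + h = t₀ + (j + 1 : ℕ) * h := fun j => by
    push_cast
    ring
  set A : ℕ → Set (EuclideanSpace ℝ (Fin N)) :=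
    fun j => {x | t₀ + j * h ≤ φ x ∧ φ x < t₀ + j * h + h} with hA
  set m : ℕ → ℝ := fun j => (weightMeasure d {x | t₀ + j * h ≤ φ x}).toReal with hm
  set e : ℕ → ℝ := fun j => (∫⁻ x in A j, ‖fderiv ℝ φ x‖ₑ ^ N).toReal with he
  have hGfin : ∀ j, ∫⁻ x in A j, ‖fderiv ℝ φ x‖ₑ ^ N ≠ ⊤ := fun j =>
    (((setLIntegral_le_lintegral _ _).trans hG).trans_lt ENNReal.one_lt_top).ne
  have hanti : ∀ j, m (j + 1) ≤ m j := fun j => by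
    refine ENNReal.toReal_mono (hfin _ (hlev j)) (measure_mono fun x hx => ?_)
    have h1 : t₀ + (j + 1 : ℕ) * h ≤ φ x := hx
    rw [← hlev'] at h1
    exact (by linarith : t₀ + j * h ≤ φ x)
  have hsum : ∑ j ∈ Finset.range n, e j ≤ 1 := by
    rw [he, ← ENNReal.toReal_sum fun j _ => hGfin j, ← lintegral_biUnion_finset]
    · refine ENNReal.toReal_le_of_le_ofReal zero_le_one ?_
      rw [ENNReal.ofReal_one]
      exact (setLIntegral_le_lintegral _ _).trans hG
    · have key : ∀ i j : ℕ, i < j → Disjoint (A i) (A j) := by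
        intro i j hij
        rw [Set.disjoint_left]
        rintro x ⟨_, h1⟩ ⟨h2, _⟩
        have h3 : ((i + 1 : ℕ) : ℝ) ≤ j := by exact_mod_cast hij
        have h4 := mul_le_mul_of_nonneg_right h3 hh0.le
        rw [hlev'] at h1
        linarith
      intro i _ j _ hij
      rcases lt_or_gt_of_ne hij with hlt | hlt
      · exact key i j hlt
      · exact (key j i hlt).symm
    · intro j _
      exact (measurableSet_le measurable_const hcφ.measurable).inter
        (measurableSet_lt hcφ.measurable measurable_const)
  have hstep : ∀ j < n, n * e j ≤ 2 → m (j + 1) ≤ θ * m j := by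
    intro j _ hj
    have hfin' : weightMeasure d {x | t₀ + j * h + h ≤ φ x} ≠ ⊤ :=
      hfin _ ((hlev j).trans (by linarith))
    have hdiff := weightMeasure_level_eq_sub (d := d) hcφ
      (show t₀ + j * h ≤ t₀ + j * h + h by linarith) hfin'
    have hm1 : m (j + 1) = (weightMeasure d {x | t₀ + j * h + h ≤ φ x}).toReal := by
      simp only [hm, hlev']
    have hAfin : weightMeasure d (A j) ≠ ⊤ :=
      ne_top_of_le_ne_top (hfin _ (hlev j)) (measure_mono fun x hx => hx.1)
    have hAreal : (weightMeasure d (A j)).toReal = m j - m (j + 1) := by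
      rw [hm1, hdiff, ENNReal.toReal_sub_of_le _ (hfin _ (hlev j))]
      exact measure_mono fun x hx => by
        have h1 : t₀ + j * h + h ≤ φ x := hx
        exact (by linarith : t₀ + j * h ≤ φ x)
    have hb := hC d φ hd hd0 hd1 hφ hφc (t₀ + j * h) h (ht0.trans_le (hlev j)) hh0
    have hprod : (∫⁻ x in A j, ‖fderiv ℝ φ x‖ₑ ^ N) ^ (1 / (N : ℝ)) *
        weightMeasure d (A j) ^ (1 / conjExp N) ≠ ⊤ :=
      ENNReal.mul_ne_top (ENNReal.rpow_ne_top_of_nonneg hs.le (hGfin j))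
        (ENNReal.rpow_ne_top_of_nonneg hr.le hAfin)
    have hprod' := ENNReal.mul_ne_top (ENNReal.ofReal_ne_top (r := h⁻¹)) hprod
    have hb' := ENNReal.toReal_mono (ENNReal.mul_ne_top ENNReal.coe_ne_top
      (ENNReal.add_ne_top.2 ⟨hprod', hfin _ (hlev j)⟩)) hb
    rw [ENNReal.toReal_mul, ENNReal.toReal_add hprod' (hfin _ (hlev j)), ENNReal.toReal_mul,
      ENNReal.toReal_mul, ← ENNReal.toReal_rpow, ← ENNReal.toReal_rpow, ← ENNReal.toReal_rpow,
      ENNReal.toReal_ofReal (inv_nonneg.2 hh0.le), hAreal, ← hm1, ENNReal.coe_toReal] at hb'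
    refine le_mul_of_rpow_le hN C.coe_nonneg ht0 (le_max_right _ _) hθ0 hθ1 hθ
      ENNReal.toReal_nonneg (hanti j) ENNReal.toReal_nonneg hn hh ?_ hj hb'
    have := ENNReal.toReal_mono ENNReal.one_ne_top (hcheb _ (hlev j))
    rwa [ENNReal.toReal_mul, ENNReal.toReal_pow, ENNReal.toReal_ofReal ht0.le,
      ENNReal.toReal_one] at this
  have hres := le_rpow_half_mul_of_dichotomy (m := m) (e := e) hθ0 hθ1 (fun j => ENNReal.toReal_nonneg)
    (fun j => ENNReal.toReal_nonneg) (fun j _ => hanti j) hstep hsum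
  rw [hnh]
  refine (ENNReal.le_ofReal_iff_toReal_le (hfin _ (hlev n)) (by positivity)).2
    (hres.trans (mul_le_of_le_one_right (by positivity) ?_))
  refine ENNReal.toReal_le_of_le_ofReal zero_le_one ?_
  rw [ENNReal.ofReal_one]
  exact hle1 _ (hlev 0)

/-! ### Bounds for Φ_N -/

theorem Phi_term_eq (N k : ℕ) (t : ℝ) :
    |t| ^ ((k : ℝ) * conjExp N) / (Nat.factorial k : ℝ) =
      (|t| ^ conjExp N) ^ k / (Nat.factorial k : ℝ) := by
  rw [mul_comm, Real.rpow_mul (abs_nonneg t), Real.rpow_natCast]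

theorem Phi_eq_exp_sub (N : ℕ) (t : ℝ) :
    Phi N t = Real.exp (|t| ^ conjExp N) -
      ∑ k ∈ Finset.range (N - 1), (|t| ^ conjExp N) ^ k / (Nat.factorial k : ℝ) := by
  have hs := Real.summable_pow_div_factorial (|t| ^ conjExp N)
  have h := hs.sum_add_tsum_subtype_compl (Finset.range (N - 1))
  rw [Real.exp_eq_exp_ℝ, NormedSpace.exp_eq_tsum_div]
  simp only
  rw [← h, add_sub_cancel_left, Phi]
  simp only [Phi_term_eq]
  refine (Equiv.subtypeEquivRight (p := fun k => N - 1 ≤ k)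
    (q := fun k => k ∉ Finset.range (N - 1)) fun k => by simp).tsum_eq
      (fun x : {k // k ∉ Finset.range (N - 1)} =>
        (|t| ^ conjExp N) ^ (x : ℕ) / (Nat.factorial x : ℝ))

theorem continuous_Phi (hN : 2 ≤ N) : Continuous (Phi N) := by
  have hp := (holderConjugate_conjExp hN).symm.nonneg
  have hs : Continuous fun t : ℝ => |t| ^ conjExp N :=
    continuous_abs.rpow_const fun _ => Or.inr hp
  rw [show Phi N = _ from funext (Phi_eq_exp_sub N)]
  fun_prop

theorem Phi_le_exp (N : ℕ) (t : ℝ) : Phi N t ≤ Real.exp (|t| ^ conjExp N) := by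
  rw [Phi_eq_exp_sub]
  exact sub_le_self _ (Finset.sum_nonneg fun _ _ => by positivity)

/-- Since k ≥ N-1, each exponent kN' is at least N, so each term is at most |t|^N/k!. -/
theorem Phi_le_of_abs_le_one (hN : 2 ≤ N) {t : ℝ} (ht : |t| ≤ 1) :
    Phi N t ≤ Real.exp 1 * |t| ^ N := by
  have hp := holderConjugate_conjExp hN
  have hsum : Summable fun k : {k : ℕ // N - 1 ≤ k} => |t| ^ N * (1 / (Nat.factorial k : ℝ)) := by
    have h := ((Real.summable_pow_div_factorial 1).comp_injective
      (Subtype.val_injective (p := fun k : ℕ => N - 1 ≤ k))).mul_left (|t| ^ N)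
    simpa [Function.comp_def] using h
  have hN1 : ((N - 1 : ℕ) : ℝ) * conjExp N = N := by
    have h : (1 : ℝ) < N := by exact_mod_cast (show 1 < N by omega)
    rw [conjExp, Nat.cast_sub (by omega), Nat.cast_one]
    field_simp [(sub_pos.2 h).ne']
  have hle : Phi N t ≤ ∑' k : {k : ℕ // N - 1 ≤ k}, |t| ^ N * (1 / (Nat.factorial k : ℝ)) := by
    refine (summable_Phi N t).tsum_le_tsum (fun k => ?_) hsum
    rw [div_eq_mul_one_div]
    gcongr
    rcases (abs_nonneg t).eq_or_lt with h0 | h0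
    · have hk : (0 : ℝ) < (k : ℕ) := by
        have := k.2
        exact_mod_cast (show 0 < (k : ℕ) by omega)
      rw [← h0, Real.zero_rpow (mul_pos hk hp.symm.pos).ne']
      positivity
    · rw [← Real.rpow_natCast]
      refine Real.rpow_le_rpow_of_exponent_ge h0 ht ?_
      conv_lhs => rw [← hN1]
      have := hp.symm.pos
      have hk : ((N - 1 : ℕ) : ℝ) ≤ (k : ℕ) := by exact_mod_cast k.2
      gcongr
  refine hle.trans ?_
  rw [tsum_mul_left, mul_comm]
  gcongr
  have h1 := Phi_le_exp N 1
  simpa [Phi] using h1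

/-- For |s| ≥ t₀ a single term of the series suffices, the one with n = ⌊(|s|-t₀)^{N'}⌋, because
then |s| ≤ (t₀+1)(n+1)^{1/N'}. -/
theorem ofReal_Phi_div_le (hN : 2 ≤ N) {t₀ a c₁ : ℝ} (ht₀ : 1 ≤ t₀)
    (hc₁ : t₀ + 1 ≤ c₁) (hac : ((t₀ + 1) / c₁) ^ conjExp N ≤ a) (s : ℝ) :
    ENNReal.ofReal (Phi N (s / c₁)) ≤ ENNReal.ofReal (Real.exp 1) * ‖s‖ₑ ^ N +
      ∑' n : ℕ, ENNReal.ofReal (Real.exp (a * (n + 1))) *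
        {r : ℝ | t₀ + (n : ℝ) ^ (1 / conjExp N) ≤ |r|}.indicator 1 s := by
  have hp := holderConjugate_conjExp hN
  have hp0 := hp.symm.pos
  have hc0 : 0 < c₁ := by linarith
  by_cases hs : |s| < t₀
  · refine le_trans ?_ le_self_add
    have hle : |s / c₁| ≤ |s| := by
      rw [abs_div, abs_of_pos hc0]
      exact div_le_self (abs_nonneg s) (by linarith)
    have h1 : |s / c₁| ≤ 1 := by
      rw [abs_div, abs_of_pos hc0, div_le_one hc0]
      linarith
    rw [← ofReal_norm, Real.norm_eq_abs, ← ENNReal.ofReal_pow (abs_nonneg s),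
      ← ENNReal.ofReal_mul (Real.exp_pos 1).le]
    refine ENNReal.ofReal_le_ofReal ((Phi_le_of_abs_le_one hN h1).trans ?_)
    gcongr
  · rw [not_lt] at hs
    refine le_trans ?_ le_add_self
    have hb : 0 ≤ |s| - t₀ := by linarith
    set n := ⌊(|s| - t₀) ^ conjExp N⌋₊ with hn
    refine le_trans ?_ (ENNReal.le_tsum n)
    have hlow : (n : ℝ) ≤ (|s| - t₀) ^ conjExp N := Nat.floor_le (by positivity)
    have hup : (|s| - t₀) ^ conjExp N ≤ n + 1 := (Nat.lt_floor_add_one _).le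
    have hmem : s ∈ {r : ℝ | t₀ + (n : ℝ) ^ (1 / conjExp N) ≤ |r|} := by
      have := Real.rpow_le_rpow n.cast_nonneg hlow (one_div_nonneg.2 hp0.le)
      rw [← Real.rpow_mul hb, mul_one_div_cancel hp0.ne', Real.rpow_one] at this
      exact (by linarith : t₀ + (n : ℝ) ^ (1 / conjExp N) ≤ |s|)
    rw [Set.indicator_of_mem hmem, Pi.one_apply, mul_one]
    refine ENNReal.ofReal_le_ofReal ((Phi_le_exp N _).trans (Real.exp_le_exp.2 ?_))
    have h2 : |s| ≤ (t₀ + 1) * (n + 1 : ℝ) ^ (1 / conjExp N) := by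
      have h3 := Real.rpow_le_rpow (by positivity) hup (one_div_nonneg.2 hp0.le)
      rw [← Real.rpow_mul hb, mul_one_div_cancel hp0.ne', Real.rpow_one] at h3
      have h4 : 1 ≤ (n + 1 : ℝ) ^ (1 / conjExp N) :=
        Real.one_le_rpow (by linarith [n.cast_nonneg (α := ℝ)]) (one_div_nonneg.2 hp0.le)
      nlinarith
    calc |s / c₁| ^ conjExp N
        ≤ ((t₀ + 1) / c₁ * (n + 1 : ℝ) ^ (1 / conjExp N)) ^ conjExp N := by
          refine Real.rpow_le_rpow (abs_nonneg _) ?_ hp0.le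
          rw [abs_div, abs_of_pos hc0, div_mul_eq_mul_div]
          gcongr
      _ = ((t₀ + 1) / c₁) ^ conjExp N * (n + 1) := by
          rw [Real.mul_rpow (by positivity) (by positivity), ← Real.rpow_mul (by positivity),
            one_div_mul_cancel hp0.ne', Real.rpow_one]
      _ ≤ a * (n + 1) := by gcongr

/-! ### The inequality for smooth weights -/

theorem measure_abs_superlevel_le {α : Type*} [MeasurableSpace α] (μ : Measure α) (f : α → ℝ)
    (r : ℝ) : μ {x | r ≤ |f x|} ≤ μ {x | r ≤ f x} + μ {x | r ≤ (-f) x} := by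
  refine (measure_mono fun x hx => ?_).trans (measure_union_le _ _)
  have h : r ≤ |f x| := hx
  exact le_abs.1 h

/-- The Trudinger inequality for test functions with the weight `d⁻ᴺ`, where `d` is any smooth
positive function with gradient at most `1`. -/
theorem exists_lintegral_Phi_weightMeasure_le (hN : 2 ≤ N) :
    ∃ c₁ c₂ : ℝ, 0 < c₁ ∧ 0 < c₂ ∧
      ∀ d φ : EuclideanSpace ℝ (Fin N) → ℝ, ContDiff ℝ 1 d → (∀ x, 0 < d x) →
      (∀ x, ‖fderiv ℝ d x‖ ≤ 1) → ContDiff ℝ 1 φ → HasCompactSupport φ →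
      ∫⁻ x, ‖fderiv ℝ φ x‖ₑ ^ N ≤ 1 → ∫⁻ x, ‖φ x‖ₑ ^ N ∂weightMeasure d ≤ 1 →
      ∫⁻ x, ENNReal.ofReal (Phi N (φ x / c₁)) ∂weightMeasure d ≤ ENNReal.ofReal c₂ := by
  have hp := holderConjugate_conjExp hN
  have hp0 := hp.symm.pos
  obtain ⟨t₀, θ, ht₀, hθ0, hθ1, hdec⟩ := exists_weightMeasure_superlevel_le_rpow hN
  -- The bound -log θ/4 makes e^{an} consume only half of the decay θ^{n/2}, leaving a geometric
  -- series of ratio θ^{1/4}. The bound 1 gives e^a ≤ e and c₁ ≥ t₀ + 1, where c₁ solves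
  -- ((t₀+1)/c₁)^{N'} = a.
  set a : ℝ := min 1 (-Real.log θ / 4) with ha
  have hlog : Real.log θ < 0 := Real.log_neg hθ0 hθ1
  have ha0 : 0 < a := lt_min one_pos (by linarith)
  have har : 0 < a ^ (1 / conjExp N) := by positivity
  have har1 : a ^ (1 / conjExp N) ≤ 1 :=
    Real.rpow_le_one ha0.le (min_le_left _ _) (one_div_nonneg.2 hp0.le)
  have hc₁ : t₀ + 1 ≤ (t₀ + 1) / a ^ (1 / conjExp N) :=
    le_div_self (by linarith) har har1
  have hac : ((t₀ + 1) / ((t₀ + 1) / a ^ (1 / conjExp N))) ^ conjExp N ≤ a := by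
    rw [div_div_cancel₀ (by linarith), ← Real.rpow_mul ha0.le, one_div_mul_cancel hp0.ne',
      Real.rpow_one]
  set ρ : ℝ := θ ^ ((1 : ℝ) / 4) with hρ
  have hρ0 : 0 < ρ := by positivity
  have hρ1 : ρ < 1 := Real.rpow_lt_one hθ0.le hθ1 (by norm_num)
  have hgeom : ∀ n : ℕ, Real.exp (a * (n + 1)) * θ ^ ((n : ℝ) / 2) ≤ Real.exp 1 * ρ ^ n := by
    intro n
    rw [hρ, ← Real.rpow_mul_natCast hθ0.le, Real.rpow_def_of_pos hθ0, Real.rpow_def_of_pos hθ0,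
      ← Real.exp_add, ← Real.exp_add]
    refine Real.exp_le_exp.2 ?_
    have h1 : a ≤ 1 := min_le_left _ _
    have h2 : a * n ≤ -Real.log θ / 4 * n :=
      mul_le_mul_of_nonneg_right (min_le_right _ _) n.cast_nonneg
    linarith
  have hsummable : Summable fun n : ℕ => 2 * Real.exp 1 * ρ ^ n :=
    (summable_geometric_of_lt_one hρ0.le hρ1).mul_left _
  have hterm0 : ∀ n : ℕ, 0 ≤ 2 * Real.exp 1 * ρ ^ n := fun n => by positivity
  refine ⟨(t₀ + 1) / a ^ (1 / conjExp N),
    Real.exp 1 + ∑' n : ℕ, 2 * Real.exp 1 * ρ ^ n, by positivity,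
    add_pos_of_pos_of_nonneg (Real.exp_pos 1) (tsum_nonneg hterm0), ?_⟩
  intro d φ hd hd0 hd1 hφ hφc hG hV
  have hcφ := hφ.continuous
  have hset : ∀ n : ℕ, MeasurableSet {r : ℝ | t₀ + (n : ℝ) ^ (1 / conjExp N) ≤ |r|} := fun n =>
    measurableSet_le measurable_const continuous_abs.measurable
  have hbound : ∀ n : ℕ, weightMeasure d {x | t₀ + (n : ℝ) ^ (1 / conjExp N) ≤ |φ x|} ≤
      2 * ENNReal.ofReal (θ ^ ((n : ℝ) / 2)) := by
    intro n
    have hneg := hdec d (-φ) hd hd0 hd1 hφ.neg hφc.neg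
      (by simpa only [fderiv_neg, enorm_neg] using hG)
      (by simpa only [Pi.neg_apply, enorm_neg] using hV) n
    have hpos := hdec d φ hd hd0 hd1 hφ hφc hG hV n
    rw [two_mul]
    exact (measure_abs_superlevel_le _ φ _).trans (add_le_add hpos hneg)
  calc _ ≤ ∫⁻ x, (ENNReal.ofReal (Real.exp 1) * ‖φ x‖ₑ ^ N +
        ∑' n : ℕ, ENNReal.ofReal (Real.exp (a * (n + 1))) *
          {r : ℝ | t₀ + (n : ℝ) ^ (1 / conjExp N) ≤ |r|}.indicator 1 (φ x)) ∂weightMeasure d :=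
        lintegral_mono fun x => ofReal_Phi_div_le hN ht₀ hc₁ hac (φ x)
    _ = ENNReal.ofReal (Real.exp 1) * ∫⁻ x, ‖φ x‖ₑ ^ N ∂weightMeasure d +
        ∑' n : ℕ, ENNReal.ofReal (Real.exp (a * (n + 1))) *
          weightMeasure d {x | t₀ + (n : ℝ) ^ (1 / conjExp N) ≤ |φ x|} := by
        have hm : ∀ n : ℕ, Measurable fun x =>
            {r : ℝ | t₀ + (n : ℝ) ^ (1 / conjExp N) ≤ |r|}.indicator (1 : ℝ → ℝ≥0∞) (φ x) :=
          fun n => (measurable_one.indicator (hset n)).comp hcφ.measurable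
        rw [lintegral_add_left ((hcφ.measurable.enorm.pow_const N).const_mul _),
          lintegral_const_mul _ (hcφ.measurable.enorm.pow_const N),
          lintegral_tsum fun n => ((hm n).const_mul _).aemeasurable]
        congr 1
        refine tsum_congr fun n => ?_
        rw [lintegral_const_mul _ (hm n)]
        congr 1
        exact lintegral_indicator_one (hcφ.measurable (hset n))
    _ ≤ ENNReal.ofReal (Real.exp 1) * 1 +
        ∑' n : ℕ, ENNReal.ofReal (2 * Real.exp 1 * ρ ^ n) := by
        refine add_le_add (mul_le_mul_right hV _) (ENNReal.tsum_le_tsum fun n => ?_)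
        refine (mul_le_mul_right (hbound n) _).trans ?_
        rw [mul_left_comm, ← ENNReal.ofReal_mul (Real.exp_pos _).le, mul_assoc,
          ENNReal.ofReal_mul zero_le_two, ENNReal.ofReal_ofNat]
        exact mul_le_mul_right (ENNReal.ofReal_le_ofReal (hgeom n)) _
    _ = _ := by
        rw [mul_one, ENNReal.ofReal_add (Real.exp_pos 1).le (tsum_nonneg hterm0),
          ENNReal.ofReal_tsum_of_nonneg hterm0 hsummable]

/-! ### Regularised distance and passage to W_0^{1,N} -/

/-- Averaging over balls of radius ε keeps the Lipschitz constant and moves δ by at most ε. Adding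
2ε puts d above δ, so that d⁻¹ ≤ δ⁻¹ where δ > 0, and keeps d ≥ ε when δ ≥ 0. -/
theorem exists_smooth_lipschitz_approx {δ : EuclideanSpace ℝ (Fin N) → ℝ} (hδ : LipschitzWith 1 δ)
    {ε : ℝ} (hε : 0 < ε) :
    ∃ d : EuclideanSpace ℝ (Fin N) → ℝ, ContDiff ℝ 1 d ∧ (∀ x, ‖fderiv ℝ d x‖ ≤ 1) ∧
      ∀ x, δ x + ε ≤ d x ∧ d x ≤ δ x + 3 * ε := by
  let η : ContDiffBump (0 : EuclideanSpace ℝ (Fin N)) := ⟨ε / 2, ε, by positivity, by linarith⟩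
  have hc := hδ.continuous
  have hli : LocallyIntegrable δ (volume : Measure (EuclideanSpace ℝ (Fin N))) :=
    hc.locallyIntegrable
  set d₀ := convolution (η.normed volume) δ (ContinuousLinearMap.lsmul ℝ ℝ) volume with hd₀
  have hsm : ContDiff ℝ 1 d₀ :=
    HasCompactSupport.contDiff_convolution_left (n := 1) _ η.hasCompactSupport_normed
      (ContDiffBump.contDiff_normed η) hli
  have hint : ∀ x, Integrable fun t => η.normed volume t * δ (x - t) := fun x =>
    (η.hasCompactSupport_normed (μ := volume)).convolutionExists_left
      (ContinuousLinearMap.lsmul ℝ ℝ) (η.contDiff_normed (n := 0)).continuous hli x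
  have hlip : LipschitzWith 1 d₀ := by
    refine LipschitzWith.of_dist_le_mul fun x y => ?_
    have hdef : ∀ z, d₀ z = ∫ t, η.normed volume t * δ (z - t) := fun z => rfl
    rw [dist_eq_norm, hdef, hdef, ← integral_sub (hint x) (hint y)]
    refine (norm_integral_le_of_norm_le ((η.integrable_normed (μ := volume)).mul_const (dist x y))
      (Eventually.of_forall fun t => ?_)).trans ?_
    · rw [← mul_sub, norm_mul, Real.norm_of_nonneg (η.nonneg_normed t)]
      refine mul_le_mul_of_nonneg_left ?_ (η.nonneg_normed t)
      have := hδ.dist_le_mul (x - t) (y - t)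
      rwa [dist_sub_right, NNReal.coe_one, one_mul, dist_eq_norm (δ _)] at this
    · rw [integral_mul_const, η.integral_normed, NNReal.coe_one]
  have hclose : ∀ x, |d₀ x - δ x| ≤ ε := fun x => by
    have := ContDiffBump.dist_normed_convolution_le (φ := η) (μ := volume) (g := δ) (x₀ := x)
      (ε := ε) hc.aestronglyMeasurable fun y hy => by
        refine (hδ.dist_le_mul y x).trans ?_
        rw [NNReal.coe_one, one_mul]
        exact (Metric.mem_ball.1 hy).le
    rwa [Real.dist_eq] at this
  refine ⟨fun x => d₀ x + 2 * ε, hsm.add contDiff_const, fun x => ?_, fun x => ?_⟩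
  · rw [fderiv_add_const]
    exact norm_fderiv_le_of_lipschitz ℝ hlip
  · have := abs_le.1 (hclose x)
    constructor <;> linarith

theorem eLpNorm_natCast_le_one_iff {α F : Type*} [MeasurableSpace α] [NormedAddCommGroup F]
    {μ : Measure α} {f : α → F} (hN : N ≠ 0) :
    eLpNorm f N μ ≤ 1 ↔ ∫⁻ x, ‖f x‖ₑ ^ N ∂μ ≤ 1 := by
  have h : (0 : ℝ) < N := by exact_mod_cast Nat.pos_of_ne_zero hN
  rw [eLpNorm_eq_lintegral_rpow_enorm_toReal (by exact_mod_cast hN) (ENNReal.natCast_ne_top N),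
    ENNReal.toReal_natCast, one_div, ENNReal.rpow_inv_le_iff h, ENNReal.one_rpow]
  simp only [ENNReal.rpow_natCast]

theorem lintegral_le_of_tendsto_of_eventually_le {α : Type*} [MeasurableSpace α] {μ : Measure α}
    {f : ℕ → α → ℝ≥0∞} {g : α → ℝ≥0∞} {C : ℝ≥0∞} (hf : ∀ n, AEMeasurable (f n) μ)
    (hlim : ∀ᵐ x ∂μ, Tendsto (fun n => f n x) atTop (𝓝 (g x)))
    (hC : ∀ᶠ n in atTop, ∫⁻ x, f n x ∂μ ≤ C) : ∫⁻ x, g x ∂μ ≤ C := by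
  calc ∫⁻ x, g x ∂μ = ∫⁻ x, liminf (fun n => f n x) atTop ∂μ :=
        lintegral_congr_ae (hlim.mono fun x hx => hx.liminf_eq.symm)
    _ ≤ liminf (fun n => ∫⁻ x, f n x ∂μ) atTop := lintegral_liminf_le' hf
    _ ≤ C := liminf_le_of_frequently_le' hC.frequently

/-- If the bound by `1` holds for `f`, then it holds for the halves of functions close to `f`. -/
theorem eventually_eLpNorm_half_le_one {α F : Type*} [MeasurableSpace α] [NormedAddCommGroup F]
    [NormedSpace ℝ F] {μ : Measure α} {p : ℝ≥0∞} (hp : 1 ≤ p) {f : α → F} {g : ℕ → α → F}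
    (hf : AEStronglyMeasurable f μ) (hg : ∀ n, AEStronglyMeasurable (g n) μ)
    (hf1 : eLpNorm f p μ ≤ 1)
    (hlim : Tendsto (fun n => eLpNorm (fun x => f x - g n x) p μ) atTop (𝓝 0)) :
    ∀ᶠ n in atTop, eLpNorm (fun x => (2⁻¹ : ℝ) • g n x) p μ ≤ 1 := by
  filter_upwards [hlim.eventually (ge_mem_nhds one_pos)] with n hn
  have h1 : eLpNorm (g n) p μ ≤ 2 := by
    have e : g n = f - (fun x => f x - g n x) := by
      ext x
      simp
    rw [e, ← one_add_one_eq_two]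
    exact (eLpNorm_sub_le hf (hf.sub (hg n)) hp).trans (add_le_add hf1 hn)
  have h2 := eLpNorm_const_smul (2⁻¹ : ℝ) (g n) p μ
  change eLpNorm ((2⁻¹ : ℝ) • g n) p μ ≤ 1
  rw [h2, Real.enorm_of_nonneg (by norm_num), ENNReal.ofReal_inv_of_pos two_pos,
    ENNReal.ofReal_ofNat]
  calc (2 : ℝ≥0∞)⁻¹ * eLpNorm (g n) p μ ≤ 2⁻¹ * 2 := by gcongr
    _ = 1 := ENNReal.inv_mul_cancel two_ne_zero ENNReal.ofNat_ne_top

theorem norm_gradient_eq (φ : EuclideanSpace ℝ (Fin N) → ℝ) (x : EuclideanSpace ℝ (Fin N)) :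
    ‖gradient φ x‖ = ‖fderiv ℝ φ x‖ :=
  LinearIsometryEquiv.norm_map _ _

theorem lintegral_enorm_fderiv_half_eq {Ω : Set (EuclideanSpace ℝ (Fin N))} (hN : N ≠ 0)
    {φ : EuclideanSpace ℝ (Fin N) → ℝ} (hφ : IsTestFunction Ω φ) :
    ∫⁻ x, ‖fderiv ℝ (fun y => 2⁻¹ * φ y) x‖ₑ ^ N =
      ∫⁻ x in Ω, ‖(2⁻¹ : ℝ) • gradient φ x‖ₑ ^ N := by
  have hd : ∀ x, fderiv ℝ (fun y => 2⁻¹ * φ y) x = (2⁻¹ : ℝ) • fderiv ℝ φ x := fun x =>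
    fderiv_const_mul (hφ.contDiff.differentiable (by simp) x) _
  have he : ∀ x, ‖fderiv ℝ (fun y => 2⁻¹ * φ y) x‖ₑ = ‖(2⁻¹ : ℝ) • gradient φ x‖ₑ := fun x => by
    rw [hd, enorm_smul, enorm_smul, ← ofReal_norm (gradient φ x), norm_gradient_eq, ofReal_norm]
  rw [← setLIntegral_eq_of_support_subset (s := Ω)]
  · simp only [he]
  · refine fun x hx => hφ.tsupport_subset (support_fderiv_subset ℝ fun h0 => hx ?_)
    simp only [hd, h0, smul_zero, ← ofReal_norm, norm_zero, ENNReal.ofReal_zero, zero_pow hN]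

/-- Approximants of u may slightly violate the norm bounds, but their halves eventually satisfy
them. As d ≥ ε, multiplication by d⁻¹ is bounded on L^N, so L^N convergence controls the weighted
norm. Fatou applies along an a.e. convergent subsequence. -/
theorem lintegral_Phi_weight_le_of_memW10 (hN : 2 ≤ N) {c₁ c₂ : ℝ}
    (H : ∀ d φ : EuclideanSpace ℝ (Fin N) → ℝ, ContDiff ℝ 1 d → (∀ x, 0 < d x) →
      (∀ x, ‖fderiv ℝ d x‖ ≤ 1) → ContDiff ℝ 1 φ → HasCompactSupport φ →
      ∫⁻ x, ‖fderiv ℝ φ x‖ₑ ^ N ≤ 1 → ∫⁻ x, ‖φ x‖ₑ ^ N ∂weightMeasure d ≤ 1 →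
      ∫⁻ x, ENNReal.ofReal (Phi N (φ x / c₁)) ∂weightMeasure d ≤ ENNReal.ofReal c₂)
    {Ω : Set (EuclideanSpace ℝ (Fin N))} {u d : EuclideanSpace ℝ (Fin N) → ℝ} {ε : ℝ}
    (hd : ContDiff ℝ 1 d) (hd1 : ∀ x, ‖fderiv ℝ d x‖ ≤ 1) (hε : 0 < ε) (hdε : ∀ x, ε ≤ d x)
    (hu : MemW10 Ω N u) (hG : eLpNorm (weakGradient Ω u) N (volume.restrict Ω) ≤ 1)
    (hV : eLpNorm (fun x => (d x)⁻¹ * u x) N (volume.restrict Ω) ≤ 1) :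
    ∫⁻ x in Ω, weight d x ^ N * ENNReal.ofReal (Phi N (2⁻¹ * u x / c₁)) ≤ ENNReal.ofReal c₂ := by
  have hN0 : N ≠ 0 := by omega
  have hp1 : (1 : ℝ≥0∞) ≤ N := by exact_mod_cast (show 1 ≤ N by omega)
  have hd0 : ∀ x, 0 < d x := fun x => hε.trans_le (hdε x)
  have hcd := hd.continuous
  obtain ⟨φ, hφ, hlim, hlimG⟩ := hu.exists_approx
  have hφc : ∀ n, Continuous (φ n) := fun n => (hφ n).contDiff.continuous
  have hum := hu.memW1.memLp.aestronglyMeasurable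
  have hinvc : Continuous fun x => (d x)⁻¹ := hcd.inv₀ fun x => (hd0 x).ne'
  have hgc : ∀ n, Continuous (gradient (φ n)) := fun n =>
    (LinearIsometryEquiv.continuous _).comp ((hφ n).contDiff.continuous_fderiv (by simp))
  have hlimV : Tendsto (fun n => eLpNorm (fun x => (d x)⁻¹ * u x - (d x)⁻¹ * φ n x) N
      (volume.restrict Ω)) atTop (𝓝 0) := by
    have h1 : Tendsto (fun n => ENNReal.ofReal ε⁻¹ *
        eLpNorm (fun x => u x - φ n x) N (volume.restrict Ω)) atTop (𝓝 0) := by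
      simpa using ENNReal.Tendsto.const_mul hlim (Or.inr (ENNReal.ofReal_ne_top (r := ε⁻¹)))
    refine tendsto_of_tendsto_of_tendsto_of_le_of_le tendsto_const_nhds h1
      (fun n => zero_le) fun n => ?_
    refine eLpNorm_le_mul_eLpNorm_of_ae_le_mul (Eventually.of_forall fun x => ?_) _
    rw [← mul_sub, norm_mul, Real.norm_of_nonneg (inv_nonneg.2 (hd0 x).le)]
    exact mul_le_mul_of_nonneg_right (inv_anti₀ hε (hdε x)) (norm_nonneg _)
  have evG := eventually_eLpNorm_half_le_one hp1
    hu.memW1.memLp_weakGradient.aestronglyMeasurable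
    (fun n => (hgc n).aestronglyMeasurable) hG hlimG
  have evV := eventually_eLpNorm_half_le_one hp1
    (hinvc.aestronglyMeasurable.mul hum)
    (fun n => (hinvc.mul (hφc n)).aestronglyMeasurable) hV hlimV
  have hbound : ∀ᶠ n in atTop, ∫⁻ x in Ω, weight d x ^ N *
      ENNReal.ofReal (Phi N (2⁻¹ * φ n x / c₁)) ≤ ENNReal.ofReal c₂ := by
    filter_upwards [evG, evV] with n hn1 hn2
    rw [eLpNorm_natCast_le_one_iff hN0] at hn1 hn2
    have hψ : ContDiff ℝ 1 fun y => 2⁻¹ * φ n y :=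
      contDiff_const.mul ((hφ n).contDiff.of_le (by simp))
    have hPhim : Measurable fun x => ENNReal.ofReal (Phi N (2⁻¹ * φ n x / c₁)) :=
      ((continuous_Phi hN).comp ((hψ.continuous).div_const c₁)).measurable.ennreal_ofReal
    have h := H d _ hd hd0 hd1 hψ ((hφ n).hasCompactSupport.mul_left (f := fun _ => 2⁻¹))
      ((lintegral_enorm_fderiv_half_eq hN0 (hφ n)).trans_le hn1) ?_
    · rw [lintegral_weightMeasure hcd hPhim] at h
      exact (setLIntegral_le_lintegral _ _).trans h
    · rw [lintegral_weightMeasure hcd (hψ.continuous.measurable.enorm.pow_const N)]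
      refine le_trans (le_of_eq ?_) hn2
      rw [← setLIntegral_eq_of_support_subset (s := Ω)]
      · refine lintegral_congr fun x => ?_
        rw [← enorm_inv_eq_weight hd0, ← mul_pow, ← enorm_mul, smul_eq_mul, mul_left_comm,
          Pi.mul_apply]
      · refine fun x hx => (hφ n).tsupport_subset (subset_tsupport _ fun h0 => hx ?_)
        simp only [h0, mul_zero, enorm_zero, zero_pow hN0]
  obtain ⟨ns, hns, hae⟩ := (tendstoInMeasure_of_tendsto_eLpNorm
    (one_pos.trans_le hp1).ne' (fun n => (hφc n).aestronglyMeasurable) hum (by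
      simp_rw [eLpNorm_sub_comm _ u]
      exact hlim)).exists_seq_tendsto_ae
  refine lintegral_le_of_tendsto_of_eventually_le
    (f := fun n x => weight d x ^ N * ENNReal.ofReal (Phi N (2⁻¹ * φ (ns n) x / c₁)))
    (fun n => ?_) ?_ (hns.tendsto_atTop.eventually hbound)
  · exact (((measurable_weight hcd).pow_const N).mul ((continuous_Phi hN).comp
      (((hφc _).const_mul 2⁻¹).div_const c₁)).measurable.ennreal_ofReal).aemeasurable
  · filter_upwards [hae] with x hx
    refine ENNReal.Tendsto.const_mul (ENNReal.tendsto_ofReal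
      (((continuous_Phi hN).tendsto _).comp ((hx.const_mul _).div_const _))) (Or.inr ?_)
    exact ENNReal.pow_ne_top ENNReal.ofReal_ne_top

theorem lipschitzWith_bdryDist (Ω : Set (EuclideanSpace ℝ (Fin N))) :
    LipschitzWith 1 (bdryDist Ω) :=
  Metric.lipschitz_infDist_pt _

theorem bdryDist_pos {Ω : Set (EuclideanSpace ℝ (Fin N))} (hΩ : IsOpen Ω)
    (hne : (frontier Ω).Nonempty) {x : EuclideanSpace ℝ (Fin N)} (hx : x ∈ Ω) :
    0 < bdryDist Ω x := by
  refine (isClosed_frontier.notMem_iff_infDist_pos hne).1 fun h => ?_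
  rw [hΩ.frontier_eq] at h
  exact h.2 hx

theorem lintegral_le_one_of_M_le_one (hN : N ≠ 0) {Ω : Set (EuclideanSpace ℝ (Fin N))}
    {u : EuclideanSpace ℝ (Fin N) → ℝ} (hM : M Ω N u ≤ 1) :
    ∫⁻ x in Ω, ENNReal.ofReal
      (‖weakGradient Ω u x‖ ^ N + |u x| ^ N / bdryDist Ω x ^ N) ≤ 1 := by
  have h : (0 : ℝ) < N := by exact_mod_cast Nat.pos_of_ne_zero hN
  rw [M, one_div, ENNReal.rpow_inv_le_iff h, ENNReal.one_rpow] at hM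
  simpa only [Real.rpow_natCast] using hM

end HardyTrudinger

end

theorem theorem5 (N : ℕ) (hN : 2 ≤ N) :
    ∃ c₁ c₂ : ℝ, 0 < c₁ ∧ 0 < c₂ ∧
      ∀ Ω : Set (EuclideanSpace ℝ (Fin N)), IsOpen Ω → IsConnected Ω → (frontier Ω).Nonempty →
        ∀ u : EuclideanSpace ℝ (Fin N) → ℝ,
          HardyTrudinger.MemW10 Ω (N : ENNReal) u →
          HardyTrudinger.M Ω (N : ℝ) u = 1 →
            ∫⁻ x in Ω, ENNReal.ofReal
              (HardyTrudinger.Phi N (u x / c₁) / HardyTrudinger.bdryDist Ω x ^ N)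
              ≤ ENNReal.ofReal c₂ := by
  obtain ⟨c₁, c₂, hc₁, hc₂, H⟩ := HardyTrudinger.exists_lintegral_Phi_weightMeasure_le hN
  -- The factor 2 pays for halving the approximants.
  refine ⟨2 * c₁, c₂, by positivity, hc₂, ?_⟩
  intro Ω hΩ _ hne u hu hM
  have hN0 : N ≠ 0 := by omega
  have hI := HardyTrudinger.lintegral_le_one_of_M_le_one hN0 hM.le
  have hδpos := fun x (hx : x ∈ Ω) => HardyTrudinger.bdryDist_pos hΩ hne hx
  have hG : eLpNorm (HardyTrudinger.weakGradient Ω u) N (volume.restrict Ω) ≤ 1 := by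
    rw [HardyTrudinger.eLpNorm_natCast_le_one_iff hN0]
    refine le_trans (setLIntegral_mono' hΩ.measurableSet fun x hx => ?_) hI
    have := hδpos x hx
    rw [← ofReal_norm, ← ENNReal.ofReal_pow (norm_nonneg _)]
    exact ENNReal.ofReal_le_ofReal (le_add_of_nonneg_right (by positivity))
  have hε : ∀ k : ℕ, (0 : ℝ) < 1 / ((k : ℝ) + 1) := fun k => by positivity
  choose d hd hd1 hdδ using fun k : ℕ => HardyTrudinger.exists_smooth_lipschitz_approx
    (HardyTrudinger.lipschitzWith_bdryDist Ω) (hε k)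
  have hδ0 : ∀ x, 0 ≤ HardyTrudinger.bdryDist Ω x := fun x => Metric.infDist_nonneg
  have hdε : ∀ (k : ℕ) x, 1 / ((k : ℝ) + 1) ≤ d k x := fun k x => by
    linarith [(hdδ k x).1, hδ0 x]
  -- Since d_k ≥ δ, the weighted norm with d_k is dominated by the one with δ.
  have hV : ∀ k, eLpNorm (fun x => (d k x)⁻¹ * u x) N (volume.restrict Ω) ≤ 1 := by
    intro k
    rw [HardyTrudinger.eLpNorm_natCast_le_one_iff hN0]
    refine le_trans (setLIntegral_mono' hΩ.measurableSet fun x hx => ?_) hI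
    have hδx := hδpos x hx
    have hle : HardyTrudinger.bdryDist Ω x ≤ d k x := by linarith [(hdδ k x).1, hε k]
    rw [← ofReal_norm, ← ENNReal.ofReal_pow (norm_nonneg _), norm_mul,
      Real.norm_of_nonneg (inv_nonneg.2 (hδx.le.trans hle)), Real.norm_eq_abs, mul_pow, inv_pow,
      inv_mul_eq_div]
    refine ENNReal.ofReal_le_ofReal (le_trans ?_ (le_add_of_nonneg_left (by positivity)))
    gcongr
  have hbound := fun k => HardyTrudinger.lintegral_Phi_weight_le_of_memW10 hN H (hd k) (hd1 k)
    (hε k) (hdε k) hu hG (hV k)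
  have hdlim : ∀ x, Tendsto (fun k => d k x) atTop (𝓝 (HardyTrudinger.bdryDist Ω x)) := by
    intro x
    have h0 := tendsto_one_div_add_atTop_nhds_zero_nat (𝕜 := ℝ)
    refine tendsto_of_tendsto_of_tendsto_of_le_of_le ?_ ?_
      (fun k => (hdδ k x).1) (fun k => (hdδ k x).2)
    · simpa using h0.const_add (HardyTrudinger.bdryDist Ω x)
    · simpa using (h0.const_mul 3).const_add (HardyTrudinger.bdryDist Ω x)
  -- Fatou as k → ∞: the weights converge pointwise on Ω because δ > 0 there.
  refine HardyTrudinger.lintegral_le_of_tendsto_of_eventually_le (fun k => ?_) ?_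
    (Eventually.of_forall hbound)
  · refine ((HardyTrudinger.measurable_weight (hd k).continuous).pow_const N).aemeasurable.mul ?_
    exact (((HardyTrudinger.continuous_Phi hN).measurable.comp_aemeasurable
      ((hu.memW1.memLp.aestronglyMeasurable.aemeasurable.const_mul 2⁻¹).div_const
        c₁))).ennreal_ofReal
  · filter_upwards [ae_restrict_mem hΩ.measurableSet] with x hx
    have hδx := hδpos x hx
    have e : ENNReal.ofReal (HardyTrudinger.Phi N (u x / (2 * c₁)) /
        HardyTrudinger.bdryDist Ω x ^ N) =
        ENNReal.ofReal (HardyTrudinger.bdryDist Ω x)⁻¹ ^ N *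
          ENNReal.ofReal (HardyTrudinger.Phi N (2⁻¹ * u x / c₁)) := by
      rw [← ENNReal.ofReal_pow (inv_nonneg.2 hδx.le), ← ENNReal.ofReal_mul (by positivity),
        inv_pow, inv_mul_eq_div, inv_mul_eq_div, div_div]
    rw [e]
    refine ENNReal.Tendsto.mul_const ?_ (Or.inr ENNReal.ofReal_ne_top)
    exact ((ENNReal.continuous_pow N).tendsto _).comp
      (ENNReal.tendsto_ofReal ((hdlim x).inv₀ hδx.ne'))
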